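/- Let $X$ be a finite CW complex and $d\ge 1$ an integer. Write $X_k$ for the set of $k$-cells, $X^{(k)}$ for the $k$-skeleton ($X^{(-1)}=\emptyset$), $Z_k$, $B_k$, $H_k$ for cellular cycles, boundaries and homology, and $\beta_k(Y)=\dim H_k(Y;\mathbb Q)$ (with $\beta_{-1}=0$). A $(d-1)$-dimensional spanning co-tree of $X$ is a subcomplex $L$ with $X^{(d-2)}\subseteq L\subseteq X^{(d-1)}$ such that the inclusion induces an isomorphism $H_{d-1}(L;\mathbb Q)\to H_{d-1}(X;\mathbb Q)$ and $\beta_{d-2}(L)=\beta_{d-2}(X)$. For such $L$ let $\phi_L\colon Z_{d-1}(L;\mathbb Q)\cong H_{d-1}(L;\mathbb Q)\to H_{d-1}(X;\mathbb Q)$, let $\psi_L\colon H_{d-1}(X;\mathbb Q)\to Z_{d-1}(X;\mathbb Q)$ be $\phi_L^{-1}$ followed by the inclusion $Z_{d-1}(L;\mathbb Q)\subseteq Z_{d-1}(X;\mathbb Q)$, and let $a_L=|H_{d-1}(X,L;\mathbb Z)|$. Given $E\colon X_{d-1}\to\mathbb R$ and $\beta>0$, put $$\tau_L=a_L^2\prod_{b\in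 L_{d-1}}e^{-\beta E_b},\qquad \nabla=\sum_L\tau_L,$$ where $L$ runs over all $(d-1)$-dimensional spanning co-trees, and for $x\in H_{d-1}(X;\mathbb Z)$ with image $\bar x\in H_{d-1}(X;\mathbb Q)$ let $$\rho^B(x)=\frac1\nabla\sum_L\tau_L\,\psi_L(\bar x)\in Z_{d-1}(X;\mathbb R)$$ be the higher Boltzmann distribution at $x$. Assume that $E$ is injective. Then the function $L\mapsto\sum_{b\in L_{d-1}}E_b$ on the set of $(d-1)$-dimensional spanning co-trees has a unique minimizer $L^\mu$, and $$\lim_{\beta\to\infty}\frac{\tau_L}{\nabla}=\begin{cases}1 & L=L^\mu,\\ 0 & L\ne L^\mu.\end{cases}$$ Moreover, for every $x\in H_{d-1}(X;\mathbb Z)$, $\rho^B(x)\to\psi_{L^\mu}(\bar x)$ as $\beta\to\infty$; in particular the limit is a rational $(d-1)$-cycle. -/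

import Mathlib

open Topology Topology.CWComplex Metric Set Filter CategoryTheory CategoryTheory.Limits

universe u

noncomputable section

namespace CellBoltzmann

/-! ## Singular homology of pairs -/

/-- The singular chain complex of a space, with integer coefficients. -/
abbrev singChains : TopCat.{u} ⥤ ChainComplex (ModuleCat.{u} ℤ) ℕ :=
  (AlgebraicTopology.singularChainComplexFunctor (ModuleCat.{u} ℤ)).obj
    (ModuleCat.of ℤ (ULift.{u} ℤ))

/-- The singular homology `H_k(Y; ℤ)`. -/
abbrev singH (k : ℕ) (Y : TopCat.{u}) : ModuleCat.{u} ℤ := (singChains.obj Y).homology k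

/-- The map induced on singular homology by a continuous map. -/
abbrev singHMap (k : ℕ) {Y Y' : TopCat.{u}} (g : Y ⟶ Y') : singH k Y ⟶ singH k Y' :=
  HomologicalComplex.homologyMap (singChains.map g) k

/-- The relative singular chain complex of the pair given by an inclusion `i : A ⟶ Y`. -/
abbrev relChains {A Y : TopCat.{u}} (i : A ⟶ Y) : ChainComplex (ModuleCat.{u} ℤ) ℕ :=
  cokernel (singChains.map i)

/-- The relative singular homology `H_k(Y, A; ℤ)`. -/
abbrev relH (k : ℕ) {A Y : TopCat.{u}} (i : A ⟶ Y) : ModuleCat.{u} ℤ := (relChains i).homology k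

/-- The natural map `H_k(Y; ℤ) → H_k(Y, A; ℤ)`. -/
abbrev toRelH (k : ℕ) {A Y : TopCat.{u}} (i : A ⟶ Y) : singH k Y ⟶ relH k i :=
  HomologicalComplex.homologyMap (cokernel.π (singChains.map i)) k

/-- The map `H_k(Y, A; ℤ) → H_k(Y', A'; ℤ)` induced by a map of pairs `(g, h)`. -/
abbrev relHMap (k : ℕ) {A Y A' Y' : TopCat.{u}} (i : A ⟶ Y) (i' : A' ⟶ Y')
    (h : A ⟶ A') (g : Y ⟶ Y') (w : i ≫ g = h ≫ i') : relH k i ⟶ relH k i' :=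
  HomologicalComplex.homologyMap
    (cokernel.map (singChains.map i) (singChains.map i') (singChains.map h) (singChains.map g)
      (by rw [← Functor.map_comp, w, Functor.map_comp])) k

/-! ## Fundamental classes of discs and spheres

As in Mathlib's CW complexes, the `k`-disc is the closed unit ball of `Fin k → ℝ`. -/

/-- The `k`-disc. -/
abbrev disc (k : ℕ) : TopCat.{u} := TopCat.of (ULift.{u} (closedBall (0 : Fin k → ℝ) 1))

/-- The boundary sphere of the `k`-disc. -/
abbrev sph (k : ℕ) : TopCat.{u} := TopCat.of (ULift.{u} (sphere (0 : Fin k → ℝ) 1))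

/-- The inclusion of the boundary sphere in the `k`-disc. -/
def sphIncl (k : ℕ) : sph.{u} k ⟶ disc.{u} k :=
  TopCat.ofHom ⟨fun x => ⟨⟨x.down.1, sphere_subset_closedBall x.down.2⟩⟩, by fun_prop⟩

/-- The map from a space to a point. -/
def toPoint (Y : TopCat.{u}) : Y ⟶ TopCat.of PUnit.{u + 1} :=
  TopCat.ofHom ⟨fun _ => PUnit.unit, continuous_const⟩

/-- A generator of the reduced homology group `H̃_k(S^k; ℤ) = ker (H_k(S^k) → H_k(pt)) ≅ ℤ`, where
`S^k` is the boundary of the `(k+1)`-disc. -/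
def sphereClass (k : ℕ) : singH k (sph.{u} (k + 1)) :=
  Classical.epsilon fun s =>
    Submodule.span ℤ {s} = LinearMap.ker (singHMap k (toPoint (sph.{u} (k + 1)))).hom

/-- A generator of `H_k(D^k, ∂D^k; ℤ) ≅ ℤ`. -/
def discClass (k : ℕ) : relH k (sphIncl.{u} k) :=
  Classical.epsilon fun s => Submodule.span ℤ {s} = ⊤

/-! ## The cellular chain complex of a CW complex -/

section CW

variable {X : Type u} [TopologicalSpace X] [T2Space X] (C : Set X) [CWComplex C]

/-- The `k`-skeleton of `C`, as a space. -/
abbrev skel (k : ℕ) : TopCat.{u} := TopCat.of (skeleton C (k : ℕ∞) : Set X)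

variable {C}

/-- The complement of the open cell `f` in the `k`-skeleton, where `k` is the dimension of `f`. -/
abbrev skelCompl {k : ℕ} (f : cell C k) : TopCat.{u} :=
  TopCat.of {x : (skeleton C (k : ℕ∞) : Set X) // x.1 ∉ openCell k f}

/-- The inclusion of the complement of the open cell `f` in the `k`-skeleton. -/
def skelComplIncl {k : ℕ} (f : cell C k) : skelCompl f ⟶ skel C k :=
  TopCat.ofHom ⟨fun x => x.1, continuous_subtype_val⟩

/-- The attaching map `∂D^{k+1} → X^{(k)}` of a `(k+1)`-cell. -/
def attachMap {k : ℕ} (e : cell C (k + 1)) : sph.{u} (k + 1) ⟶ skel C k :=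
  TopCat.ofHom ⟨fun x => ⟨map (k + 1) e x.down.1,
      RelCWComplex.cellFrontier_subset_skeleton k e ⟨_, x.down.2, rfl⟩⟩, by
    refine Continuous.subtype_mk ?_ _
    exact ((continuousOn (k + 1) e).mono sphere_subset_closedBall).comp_continuous
      (continuous_subtype_val.comp continuous_uliftDown) fun x => x.down.2⟩

/-- The characteristic map `D^k → X^{(k)}` of a `k`-cell. -/
def charMap {k : ℕ} (f : cell C k) : disc.{u} k ⟶ skel C k :=
  TopCat.ofHom ⟨fun x => ⟨map k f x.down.1,
      RelCWComplex.closedCell_subset_skeleton k f ⟨_, x.down.2, rfl⟩⟩, by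
    refine Continuous.subtype_mk ?_ _
    exact (continuousOn k f).comp_continuous
      (continuous_subtype_val.comp continuous_uliftDown) fun x => x.down.2⟩

/-- The restriction of the characteristic map of a `k`-cell to `∂D^k`; it avoids the open cell. -/
def charBdry {k : ℕ} (f : cell C k) : sph.{u} k ⟶ skelCompl f :=
  TopCat.ofHom ⟨fun x => ⟨charMap f (sphIncl k x), fun h =>
      (RelCWComplex.disjoint_skeletonLT_openCell (j := f) le_rfl).notMem_of_mem_left
        (RelCWComplex.cellFrontier_subset_skeletonLT k f ⟨_, x.down.2, rfl⟩) h⟩, by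
    refine Continuous.subtype_mk ?_ _
    exact (charMap f).hom.continuous.comp (sphIncl k).hom.continuous⟩

/-- The incidence number `⟨∂e, f⟩` of a `(k+1)`-cell `e` and a `k`-cell `f`: the degree of
`∂D^{k+1} → X^{(k)} → X^{(k)} / (X^{(k)} ∖ f) ≅ D^k / ∂D^k`, that is, the integer `m` for which the
class of the attaching map of `e` becomes, in `H_k(X^{(k)}, X^{(k)} ∖ f)`, `m` times the generator
given by the characteristic map of `f`. -/
def incidence {k : ℕ} (e : cell C (k + 1)) (f : cell C k) : ℤ :=
  Classical.epsilon fun m : ℤ =>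
    (toRelH k (skelComplIncl f)).hom ((singHMap k (attachMap e)).hom (sphereClass k)) =
      m • (relHMap k (sphIncl k) (skelComplIncl f) (charBdry f) (charMap f) rfl).hom (discClass k)

theorem I_subset_of_le {L M : Subcomplex C} (h : L ≤ M) (k : ℕ) : L.I k ⊆ M.I k := by
  intro e he
  by_contra hM
  exact (CWComplex.Subcomplex.disjoint_openCell_subcomplex_of_not_mem M hM).notMem_of_mem_left
    (RelCWComplex.map_zero_mem_openCell k e)
    (h (CWComplex.Subcomplex.openCell_subset_of_mem L he
      (RelCWComplex.map_zero_mem_openCell k e)))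

theorem mem_skeletonLT_I {k : ℕ} (e : cell C k) (m : ℕ∞) :
    e ∈ (skeletonLT C m).I k ↔ (k : ℕ∞) < m := by
  rw [CWComplex.skeletonLT_I]
  rfl

end CW

section Finite

variable {X : Type u} [TopologicalSpace X] [T2Space X] (C : Set X) [CWComplex C]
  [CWComplex.Finite C]

/-- The set `X_k` of `k`-cells is finite. -/
instance cellFintype (k : ℕ) : Fintype (cell C k) :=
  haveI : _root_.Finite (cell C k) := CWComplex.FiniteType.finite_cell k
  Fintype.ofFinite _

/-- The cellular chains `C_k(X; R)`, as coefficient functions on the set of `k`-cells. -/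
abbrev Chain (R : Type*) (k : ℕ) : Type _ := cell C k → R

/-- The cellular boundary operator `∂ : C_{k+1}(X; R) → C_k(X; R)`, `∂e = ∑_f ⟨∂e, f⟩ f`. -/
def boundary (R : Type*) [CommRing R] (k : ℕ) : Chain C R (k + 1) →ₗ[R] Chain C R k :=
  Matrix.mulVecLin (Matrix.of fun f e => (incidence e f : R))

/-- The cellular cycles `Z_k(X; R)`. -/
def cycles (R : Type*) [CommRing R] : ∀ k : ℕ, Submodule R (Chain C R k)
  | 0 => ⊤
  | k + 1 => LinearMap.ker (boundary C R k)

/-- The cellular boundaries `B_k(X; R)`. -/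
def boundaries (R : Type*) [CommRing R] (k : ℕ) : Submodule R (Chain C R k) :=
  LinearMap.range (boundary C R k)

/-- The cellular homology `H_k(X; R) = Z_k(X; R) / B_k(X; R)`. -/
abbrev Homology (R : Type*) [CommRing R] (k : ℕ) : Type _ :=
  cycles C R k ⧸ (boundaries C R k).submoduleOf (cycles C R k)

variable {C}

/-! ### Subcomplexes -/

/-- The chains `C_k(L; R) ⊆ C_k(X; R)` of a subcomplex `L`. -/
def subChains (L : Subcomplex C) (R : Type*) [CommRing R] (k : ℕ) : Submodule R (Chain C R k) where
  carrier := {c | ∀ e ∉ L.I k, c e = 0}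
  add_mem' ha hb e he := by simp [ha e he, hb e he]
  zero_mem' _ _ := rfl
  smul_mem' r c hc e he := by simp [hc e he]

/-- The cycles `Z_k(L; R)` of a subcomplex `L`. -/
def subCycles (L : Subcomplex C) (R : Type*) [CommRing R] (k : ℕ) : Submodule R (Chain C R k) :=
  subChains L R k ⊓ cycles C R k

/-- The boundaries `B_k(L; R)` of a subcomplex `L`. -/
def subBoundaries (L : Subcomplex C) (R : Type*) [CommRing R] (k : ℕ) :
    Submodule R (Chain C R k) :=
  (subChains L R (k + 1)).map (boundary C R k)

/-- The cellular homology `H_k(L; R)` of a subcomplex `L`. -/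
abbrev SubHomology (L : Subcomplex C) (R : Type*) [CommRing R] (k : ℕ) : Type _ :=
  subCycles L R k ⧸ (subBoundaries L R k).submoduleOf (subCycles L R k)

/-- The inclusion `Z_k(L; R) → Z_k(X; R)`. -/
def cyclesIncl (L : Subcomplex C) (R : Type*) [CommRing R] (k : ℕ) :
    subCycles L R k →ₗ[R] cycles C R k :=
  Submodule.inclusion inf_le_right

/-- The map `i_{L*} : H_k(L; R) → H_k(X; R)` induced by the inclusion. -/
def homologyIncl (L : Subcomplex C) (R : Type*) [CommRing R] (k : ℕ) :
    SubHomology L R k →ₗ[R] Homology C R k :=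
  Submodule.mapQ _ _ (cyclesIncl L R k) (by
    rintro x ⟨y, -, hy⟩
    exact ⟨y, hy⟩)

/-- The relative cycles `Z_k(X, L; R)`: the chains of `X` whose boundary lies in `L`. -/
def relCycles (L : Subcomplex C) (R : Type*) [CommRing R] : ∀ k : ℕ, Submodule R (Chain C R k)
  | 0 => ⊤
  | k + 1 => (subChains L R k).comap (boundary C R k)

/-- The relative cellular homology `H_k(X, L; R)`. -/
abbrev RelHomology (L : Subcomplex C) (R : Type*) [CommRing R] (k : ℕ) : Type _ :=
  relCycles L R k ⧸ (boundaries C R k ⊔ subChains L R k).submoduleOf (relCycles L R k)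

variable (C) in
/-- The Betti number `β_k(X) = dim Z_k(X; ℚ) - dim B_k(X; ℚ) = dim H_k(X; ℚ)`. -/
def betti (k : ℕ) : ℤ :=
  (Module.finrank ℚ (cycles C ℚ k) : ℤ) - Module.finrank ℚ (boundaries C ℚ k)

/-- The Betti number `β_k(L) = dim Z_k(L; ℚ) - dim B_k(L; ℚ) = dim H_k(L; ℚ)`. -/
def subBetti (L : Subcomplex C) (k : ℕ) : ℤ :=
  (Module.finrank ℚ (subCycles L ℚ k) : ℤ) - Module.finrank ℚ (subBoundaries L ℚ k)

/-! ### Spanning co-trees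

Throughout, `n = d - 1`, so that `X^{(d-2)} = skeletonLT C n` and `X^{(d-1)} = skeleton C n`. -/

/-- `L` is an `n`-dimensional spanning co-tree of the CW complex. The condition on the Betti numbers
in degree `n - 1` is empty for `n = 0`, where both vanish. -/
structure IsSpanningCotree (n : ℕ) (L : Subcomplex C) : Prop where
  bijective_homologyIncl : Function.Bijective (homologyIncl L ℚ n)
  betti_eq : ∀ k : ℕ, k + 1 = n → subBetti L k = betti C k
  skeletonLT_le : skeletonLT C (n : ℕ∞) ≤ L
  le_skeleton : L ≤ skeleton C (n : ℕ∞)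

variable (C) in
/-- The set of `n`-dimensional spanning co-trees. -/
abbrev SpanningCotree (n : ℕ) : Type u := {L : Subcomplex C // IsSpanningCotree n L}

/-- There are finitely many spanning co-trees. -/
instance (n : ℕ) : _root_.Finite (SpanningCotree C n) := by
  refine _root_.Finite.of_injective (β := Set (cell C n)) (fun L => L.1.I n) ?_
  rintro ⟨L, hL⟩ ⟨M, hM⟩ h
  have key : ∀ {L M : Subcomplex C}, IsSpanningCotree n L → IsSpanningCotree n M →
      L.I n ⊆ M.I n → ∀ k, L.I k ⊆ M.I k := by
    intro L M hL hM h k e he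
    have hk := (mem_skeletonLT_I e _).1 (I_subset_of_le hL.le_skeleton k he)
    have hk' : k ≤ n := by
      have : (k : ℕ∞) < ((n + 1 : ℕ) : ℕ∞) := by simpa using hk
      have := ENat.natCast_lt_natCast.1 this
      omega
    rcases hk'.lt_or_eq with hlt | rfl
    · exact I_subset_of_le hM.skeletonLT_le k
        ((mem_skeletonLT_I e _).2 (ENat.natCast_lt_natCast.2 hlt))
    · exact h he
  have hI : ∀ k, L.I k = M.I k := fun k =>
    (key hL hM h.le k).antisymm (key hM hL h.ge k)
  have : (L : Set X) = M := by
    rw [← CWComplex.Subcomplex.union (E := L), ← CWComplex.Subcomplex.union (E := M)]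
    simp only [iUnion_coe_set, hI]
  exact Subtype.ext (SetLike.coe_injective this)

instance (n : ℕ) : Fintype (SpanningCotree C n) := Fintype.ofFinite _

/-- The map `φ_L : Z_n(L; R) → H_n(L; R) → H_n(X; R)`. -/
def phi (L : Subcomplex C) (R : Type*) [CommRing R] (n : ℕ) :
    subCycles L R n →ₗ[R] Homology C R n :=
  homologyIncl L R n ∘ₗ Submodule.mkQ _

/-- `φ_L` is an isomorphism over `ℚ`: there are no `(n+1)`-cells in `L`. -/
theorem bijective_phi {n : ℕ} {L : Subcomplex C} (hL : IsSpanningCotree n L) :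
    Function.Bijective (phi L ℚ n) := by
  refine hL.bijective_homologyIncl.comp ⟨?_, Submodule.mkQ_surjective _⟩
  rw [← LinearMap.ker_eq_bot, Submodule.ker_mkQ, eq_bot_iff]
  rintro x ⟨y, hy, hyx⟩
  have hy0 : y = 0 := by
    funext e
    refine hy e fun he => ?_
    have := (mem_skeletonLT_I e _).1 (I_subset_of_le hL.le_skeleton (n + 1) he)
    simp at this
  refine Subtype.ext ?_
  rw [hy0, map_zero] at hyx
  exact hyx.symm

/-- The map `ψ_L = i_L ∘ φ_L⁻¹ : H_n(X; ℚ) → Z_n(L; ℚ) → Z_n(X; ℚ)` of a spanning co-tree. -/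
def psi {n : ℕ} (L : SpanningCotree C n) : Homology C ℚ n →ₗ[ℚ] cycles C ℚ n :=
  cyclesIncl L.1 ℚ n ∘ₗ (LinearEquiv.ofBijective (phi L.1 ℚ n) (bijective_phi L.2)).symm

/-- `a_L`, the order of the finite group `H_n(X, L; ℤ)`. -/
def aNum {n : ℕ} (L : SpanningCotree C n) : ℕ := Nat.card (RelHomology L.1 ℤ n)

/-- The functional `L ↦ ∑_{b ∈ L_n} E_b`. -/
def energy {n : ℕ} (E : cell C n → ℝ) (L : SpanningCotree C n) : ℝ :=
  ∑ b ∈ (Set.toFinite (L.1.I n)).toFinset, E b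

/-- The weight `τ_L = a_L² ∏_{b ∈ L_n} e^{-β E_b}`. -/
def tau {n : ℕ} (E : cell C n → ℝ) (β : ℝ) (L : SpanningCotree C n) : ℝ :=
  (aNum L : ℝ) ^ 2 * ∏ b ∈ (Set.toFinite (L.1.I n)).toFinset, Real.exp (-β * E b)

/-- `∇ = ∑_L τ_L`. -/
def nabla {n : ℕ} (E : cell C n → ℝ) (β : ℝ) : ℝ := ∑ L : SpanningCotree C n, tau E β L

/-! ### Change of coefficients -/

section Coefficients

variable (R S : Type*) [CommRing R] [CommRing S] [Algebra R S]

/-- The map `C_k(X; R) → C_k(X; S)`. -/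
def chainCast (k : ℕ) : Chain C R k →ₗ[R] Chain C S k := (Algebra.linearMap R S).compLeft _

theorem boundary_chainCast (k : ℕ) (c : Chain C R (k + 1)) :
    boundary C S k (chainCast R S (k + 1) c) = chainCast R S k (boundary C R k c) := by
  funext f
  simp [boundary, chainCast, Matrix.mulVec, dotProduct]

/-- The map `Z_k(X; R) → Z_k(X; S)`. -/
def cyclesCast (k : ℕ) : cycles C R k →ₗ[R] cycles C S k :=
  ((chainCast R S k).comp (cycles C R k).subtype).codRestrict
    ((cycles C S k).restrictScalars R) (by
      rintro ⟨c, hc⟩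
      cases k with
      | zero => trivial
      | succ k =>
        change boundary C S k (chainCast R S (k + 1) c) = 0
        rw [boundary_chainCast, show boundary C R k c = 0 from hc, map_zero])

/-- The map `H_k(X; R) → H_k(X; S)`. -/
def homologyCast (k : ℕ) : Homology C R k →ₗ[R] Homology C S k :=
  Submodule.liftQ _ (((Submodule.mkQ ((boundaries C S k).submoduleOf
      (cycles C S k))).restrictScalars R).comp (cyclesCast R S k)) (by
    rintro x ⟨y, hy⟩
    refine (Submodule.Quotient.mk_eq_zero _).2 ⟨chainCast R S (k + 1) y, ?_⟩
    rw [boundary_chainCast, hy]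
    rfl)

end Coefficients

/-- The higher Boltzmann distribution
`ρ^B = (1/∇) ∑_L τ_L ψ_L(x̄) ∈ Z_n(X; ℝ)` at an integral homology class `x ∈ H_n(X; ℤ)`. -/
def boltzmann {n : ℕ} (E : cell C n → ℝ) (β : ℝ) (x : Homology C ℤ n) : cycles C ℝ n :=
  (1 / nabla E β) • ∑ L : SpanningCotree C n,
    tau E β L • cyclesCast ℚ ℝ n (psi L (homologyCast ℤ ℚ n x))

end Finite

end CellBoltzmann

end

/-!
Over `ℚ`, a subcomplex `L` between the `(n-1)`- and the `n`-skeleton is a spanning co-tree exactly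
when the coordinate subspace `C_n(L; ℚ)` is a complement, in `C_n(X; ℚ)`, of the space
`B' = B_n(X; ℚ) ⊓ Z_n(X; ℚ)` (`isSpanningCotree_iff_isCompl`): injectivity on homology says that
`C_n(L)` meets `B'` trivially, surjectivity that `Z_n(X) ≤ C_n(L) ⊔ B'`, and the condition on Betti
numbers that `C_n(L) ⊔ Z_n(X) = ⊤`. Every set of `n`-cells is the set of `n`-cells of exactly one
such subcomplex, so the co-trees correspond to the sets `S` of `n`-cells whose coordinate subspace
is a complement of `B'`. These sets are the bases of a matroid: one exists
(`exists_isCompl_coordSubspace`), and they satisfy the basis exchange property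
(`exists_isCompl_coordSubspace_exchange`). As in the analysis of the greedy algorithm, exchange
along the element of least energy in the symmetric difference of two bases shows that an injective
energy function has only one minimal basis (`eq_of_exchange_of_sum_minimal`).

The numbers `a_L` are nonzero, since `H_n(X, L; ℤ)` is a finitely generated torsion group: rationally
every chain is the sum of a boundary and a chain of `L`. Hence `τ_L / ∇` is a Gibbs distribution with
positive prefactors `a_L²`, which concentrates at its unique ground state as `β → ∞`
(`tendsto_gibbs`). The higher Boltzmann distribution is the average of the cycles `ψ_L(x̄)` with
these weights, so it tends to the value at the ground state.
-/

namespace CellBoltzmann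

/-! ### Coordinate complements of a subspace -/

section Coordinate

variable {ι K : Type*} [Field K]

/-- The subspace of `ι → K` of the functions supported on the set `S`. -/
def coordSubspace (K : Type*) [Field K] (S : Set ι) : Submodule K (ι → K) where
  carrier := {c | ∀ e ∉ S, c e = 0}
  add_mem' ha hb e he := by simp [ha e he, hb e he]
  zero_mem' _ _ := rfl
  smul_mem' r c hc e he := by simp [hc e he]

theorem single_mem_coordSubspace [DecidableEq ι] {S : Set ι} {e : ι} (he : e ∈ S) (a : K) :
    Pi.single e a ∈ coordSubspace K S := by
  intro f hf
  have hfe : f ≠ e := fun h => hf (h ▸ he)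
  simp [hfe]

theorem eq_top_of_forall_single_mem [DecidableEq ι] [_root_.Finite ι] {W : Submodule K (ι → K)}
    (h : ∀ e, Pi.single e 1 ∈ W) : W = ⊤ := by
  have := Fintype.ofFinite ι
  refine eq_top_iff.2 fun c _ => ?_
  rw [pi_eq_sum_univ' c]
  exact Submodule.sum_mem _ fun e _ => Submodule.smul_mem _ _ (h e)

/-- Every subspace has a complement spanned by coordinate vectors, namely the one given by a maximal
set of coordinates whose span meets the subspace trivially. -/
theorem exists_isCompl_coordSubspace [_root_.Finite ι] (B : Submodule K (ι → K)) :
    ∃ S : Set ι, IsCompl (coordSubspace K S) B := by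
  classical
  obtain ⟨S, hS⟩ := (Set.toFinite {S : Set ι | Disjoint (coordSubspace K S) B}).exists_maximal
    ⟨∅, Submodule.disjoint_def.2 fun x hx _ => funext fun e => hx e (Set.notMem_empty e)⟩
  refine ⟨S, hS.prop, codisjoint_iff.2 (eq_top_of_forall_single_mem fun e => ?_)⟩
  by_cases he : e ∈ S
  · exact Submodule.mem_sup_left (single_mem_coordSubspace he 1)
  have hnd : ¬ Disjoint (coordSubspace K (insert e S)) B := fun h =>
    he (hS.le_of_ge h (Set.subset_insert e S) (Set.mem_insert e S))
  rw [Submodule.disjoint_def] at hnd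
  push Not at hnd
  obtain ⟨w, hw, hwB, hw0⟩ := hnd
  have hr : w - Pi.single e (w e) ∈ coordSubspace K S := by
    intro f hf
    obtain rfl | hfe := eq_or_ne f e
    · simp
    · simp [hfe, hw f (by simp [hfe, hf])]
  have hwe : w e ≠ 0 := by
    intro h
    rw [h, Pi.single_zero, sub_zero] at hr
    exact hw0 (Submodule.disjoint_def.1 hS.prop w hr hwB)
  have : (Pi.single e 1 : ι → K) = (w e)⁻¹ • (-(w - Pi.single e (w e)) + w) := by
    rw [neg_sub, sub_add_cancel, ← Pi.single_smul, smul_eq_mul, inv_mul_cancel₀ hwe]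
  rw [this]
  exact Submodule.smul_mem _ _ (add_mem (Submodule.mem_sup_left (neg_mem hr))
    (Submodule.mem_sup_right hwB))

/-- Basis exchange for the coordinate complements of a subspace. -/
theorem exists_isCompl_coordSubspace_exchange [_root_.Finite ι] {B : Submodule K (ι → K)}
    {S T : Set ι} (hS : IsCompl (coordSubspace K S) B) (hT : IsCompl (coordSubspace K T) B)
    {e : ι} (heS : e ∈ S) (heT : e ∉ T) :
    ∃ t ∈ T, t ∉ S ∧ IsCompl (coordSubspace K (insert e (T \ {t}))) B := by
  classical
  obtain ⟨w, hw, b, hb, hwb⟩ := Submodule.mem_sup.1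
    (hT.sup_eq_top ▸ Submodule.mem_top : (Pi.single e 1 : ι → K) ∈ coordSubspace K T ⊔ B)
  -- Some coordinate of `w` outside `S` is nonzero, since otherwise `b` lies in the span of `S`.
  obtain ⟨t, htT, htS, hwt⟩ : ∃ t ∈ T, t ∉ S ∧ w t ≠ 0 := by
    by_contra! h
    have hwS : w ∈ coordSubspace K S := fun f hf => by
      by_cases hfT : f ∈ T
      · exact h f hfT hf
      · exact hw f hfT
    have hbS : b ∈ coordSubspace K S := by
      rw [← add_sub_cancel_left w b, hwb]
      exact sub_mem (single_mem_coordSubspace heS 1) hwS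
    rw [Submodule.disjoint_def.1 hS.disjoint b hbS hb, add_zero] at hwb
    have := hw e heT
    simp [hwb] at this
  have hte : t ≠ e := by rintro rfl; exact heT htT
  refine ⟨t, htT, htS, Submodule.disjoint_def.2 fun x hx hxB => ?_,
    codisjoint_iff.2 (eq_top_of_forall_single_mem fun f => ?_)⟩
  · have hx' : x - x e • b ∈ coordSubspace K T := by
      intro f hf
      obtain rfl | hfe := eq_or_ne f e
      · have := congrFun hwb f
        simp only [Pi.add_apply, hw f hf, Pi.single_eq_same, zero_add] at this
        simp [this]
      · have := congrFun hwb f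
        simp only [Pi.add_apply, hw f hf, Pi.single_eq_of_ne hfe, zero_add] at this
        simp [this, hx f (by simp [hfe, hf])]
    have h0 := Submodule.disjoint_def.1 hT.disjoint _ hx' (sub_mem hxB (B.smul_mem _ hb))
    have hbt : b t = - w t := by
      have := congrFun hwb t
      rw [Pi.add_apply, Pi.single_eq_of_ne hte] at this
      exact eq_neg_of_add_eq_zero_right this
    have hxe : x e = 0 := by
      have := congrFun h0 t
      simpa [hx t (by simp [hte]), hbt, hwt] using this
    simpa [hxe] using h0
  · set W := coordSubspace K (insert e (T \ {t})) ⊔ B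
    have key : ∀ g ∈ coordSubspace K T, g t = 0 → g ∈ W := fun g hg hgt =>
      Submodule.mem_sup_left fun f hf => by
        by_cases hfT : f ∈ T
        · obtain rfl : f = t := by
            by_contra hft
            exact hf (Set.mem_insert_of_mem _ ⟨hfT, hft⟩)
          exact hgt
        · exact hg f hfT
    have heW : (Pi.single e 1 : ι → K) ∈ W :=
      Submodule.mem_sup_left (single_mem_coordSubspace (Set.mem_insert e _) 1)
    have htW : (Pi.single t 1 : ι → K) ∈ W := by
      have hwW : w ∈ W := by
        rw [← add_sub_cancel_right w b, hwb]
        exact sub_mem heW (Submodule.mem_sup_right hb)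
      have hd := key (w - Pi.single t (w t)) (sub_mem hw (single_mem_coordSubspace htT _)) (by simp)
      have : (Pi.single t 1 : ι → K) = (w t)⁻¹ • (w - (w - Pi.single t (w t))) := by
        rw [sub_sub_cancel, ← Pi.single_smul, smul_eq_mul, inv_mul_cancel₀ hwt]
      rw [this]
      exact W.smul_mem _ (sub_mem hwW hd)
    obtain ⟨u, hu, c, hc, huc⟩ := Submodule.mem_sup.1
      (hT.sup_eq_top ▸ Submodule.mem_top : (Pi.single f 1 : ι → K) ∈ coordSubspace K T ⊔ B)
    have hd := key (u - Pi.single t (u t)) (sub_mem hu (single_mem_coordSubspace htT _)) (by simp)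
    have : (Pi.single f 1 : ι → K) = (u - Pi.single t (u t)) + u t • Pi.single t 1 + c := by
      rw [← huc, ← Pi.single_smul, smul_eq_mul, mul_one, sub_add_cancel]
    rw [this]
    exact add_mem (add_mem hd (W.smul_mem _ htW)) (Submodule.mem_sup_right hc)

end Coordinate

/-! ### Minimal bases -/

section Minimal

variable {ι : Type*} [Fintype ι]

theorem sum_toFinset_exchange (E : ι → ℝ) {T : Set ι} {e t : ι} (he : e ∉ T) (ht : t ∈ T) :
    ∑ b ∈ (Set.toFinite (insert e (T \ {t}))).toFinset, E b =
      E e + (∑ b ∈ (Set.toFinite T).toFinset, E b - E t) := by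
  classical
  have h : (Set.toFinite (insert e (T \ {t}))).toFinset =
      insert e ((Set.toFinite T).toFinset.erase t) := by
    ext b
    simp [and_comm]
  rw [h, Finset.sum_insert (by simp [he]), Finset.sum_erase_eq_sub (by simpa using ht)]

/-- Two sets of least total energy in a family with the basis exchange property agree: otherwise
exchange the element of least energy in their symmetric difference into the set not containing
it. -/
theorem eq_of_exchange_of_sum_minimal {E : ι → ℝ} (hE : Function.Injective E)
    {P : Set ι → Prop}
    (hP : ∀ S T, P S → P T → ∀ e ∈ S, e ∉ T → ∃ t ∈ T, t ∉ S ∧ P (insert e (T \ {t})))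
    {S T : Set ι} (hS : P S) (hT : P T)
    (hSmin : ∀ U, P U → ∑ b ∈ (Set.toFinite S).toFinset, E b ≤ ∑ b ∈ (Set.toFinite U).toFinset, E b)
    (hTmin : ∀ U, P U →
      ∑ b ∈ (Set.toFinite T).toFinset, E b ≤ ∑ b ∈ (Set.toFinite U).toFinset, E b) :
    S = T := by
  have key : ∀ {S T : Set ι}, P S → P T →
      (∀ U, P U → ∑ b ∈ (Set.toFinite T).toFinset, E b ≤ ∑ b ∈ (Set.toFinite U).toFinset, E b) →
      ∀ e ∈ S, e ∉ T → ∃ t ∈ T, t ∉ S ∧ E t < E e := by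
    intro S T hS hT hmin e heS heT
    obtain ⟨t, htT, htS, ht⟩ := hP S T hS hT e heS heT
    refine ⟨t, htT, htS, lt_of_le_of_ne ?_ fun h => htS (hE h ▸ heS)⟩
    have := hmin _ ht
    rw [sum_toFinset_exchange E heT htT] at this
    linarith
  by_contra hne
  obtain ⟨e, he, hmin⟩ := (Set.toFinite (symmDiff S T)).exists_minimalFor E _
    (Set.nonempty_iff_ne_empty.2 fun h => hne (symmDiff_eq_bot.1 h))
  rcases he with ⟨heS, heT⟩ | ⟨heT, heS⟩
  · obtain ⟨t, htT, htS, hlt⟩ := key hS hT hTmin e heS heT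
    exact hlt.not_ge (hmin (Or.inr ⟨htT, htS⟩) hlt.le)
  · obtain ⟨t, htS, htT, hlt⟩ := key hT hS hSmin e heT heS
    exact hlt.not_ge (hmin (Or.inl ⟨htS, htT⟩) hlt.le)

end Minimal

/-! ### Gibbs distributions at low temperature -/

/-- A Gibbs distribution with positive prefactors concentrates at its unique ground state. -/
theorem tendsto_gibbs {ι : Type*} [Fintype ι] [DecidableEq ι] {a ε : ι → ℝ} (ha : ∀ i, 0 < a i)
    {m : ι} (hm : ∀ i, i ≠ m → ε m < ε i) (i : ι) :
    Tendsto (fun β : ℝ => a i * Real.exp (-β * ε i) / ∑ j, a j * Real.exp (-β * ε j)) atTop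
      (𝓝 (if i = m then 1 else 0)) := by
  -- Divide numerator and denominator by the term of the ground state.
  have hr : ∀ i, Tendsto (fun β : ℝ => a i / a m * Real.exp (-β * (ε i - ε m))) atTop
      (𝓝 (if i = m then 1 else 0)) := by
    intro i
    obtain rfl | hi := eq_or_ne i m
    · simp [(ha i).ne']
    · rw [if_neg hi, ← mul_zero (a i / a m)]
      refine (Real.tendsto_exp_atBot.comp ?_).const_mul _
      exact tendsto_neg_atTop_atBot.atBot_mul_const (sub_pos.2 (hm i hi))
  have hs := tendsto_finsetSum Finset.univ fun j _ => hr j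
  have := (hr i).div hs (by simp)
  simp only [Finset.sum_ite_eq', Finset.mem_univ, if_true, div_one] at this
  refine this.congr fun β => ?_
  have hj : ∀ j, a j / a m * Real.exp (-β * (ε j - ε m)) =
      a j * Real.exp (-β * ε j) / (a m * Real.exp (-β * ε m)) := by
    intro j
    rw [mul_sub, Real.exp_sub, div_mul_div_comm]
  have h0 : a m * Real.exp (-β * ε m) ≠ 0 := (mul_pos (ha m) (Real.exp_pos _)).ne'
  simp only [Pi.div_apply, hj]
  rw [← Finset.sum_div, div_div_div_cancel_right₀ h0]

/-! ### Subcomplexes between two consecutive skeleta -/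

section Subcomplexes

variable {X : Type u} [TopologicalSpace X] [T2Space X] {C : Set X} [CWComplex C]

/-- The cells of dimension less than `n` together with those in a set `S` of `n`-cells. -/
def cellsOfSet {n : ℕ} (S : Set (cell C n)) (k : ℕ) : Set (cell C k) :=
  {e | k < n ∨ ∃ f ∈ S, (⟨k, e⟩ : Σ k, cell C k) = ⟨n, f⟩}

/-- The subcomplex consisting of the `(n-1)`-skeleton and a set `S` of `n`-cells. -/
def subcomplexOfSet {n : ℕ} (S : Set (cell C n)) : Subcomplex C :=
  CWComplex.Subcomplex.mk' C (⋃ (k : ℕ) (e : cellsOfSet S k), openCell k e.1) (cellsOfSet S) (by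
    have hlt : (skeletonLT C (n : ℕ∞) : Set X) ⊆ ⋃ (k : ℕ) (e : cellsOfSet S k), openCell k e.1 := by
      rw [← CWComplex.iUnion_openCell_eq_skeletonLT]
      simp only [iUnion_subset_iff]
      intro k hk e x hx
      exact mem_iUnion₂.2 ⟨k, ⟨e, Or.inl (ENat.natCast_lt_natCast.1 hk)⟩, hx⟩
    rintro k ⟨e, he⟩
    rw [← RelCWComplex.cellFrontier_union_openCell_eq_closedCell]
    refine union_subset ?_ fun x hx => mem_iUnion₂.2 ⟨k, ⟨e, he⟩, hx⟩
    refine (RelCWComplex.cellFrontier_subset_skeletonLT k e).trans (subset_trans ?_ hlt)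
    refine RelCWComplex.skeletonLT_mono (ENat.natCast_le_natCast.2 ?_)
    rcases he with he | ⟨f, -, hf⟩
    · exact he.le
    · exact (congrArg Sigma.fst hf).le) rfl

theorem subcomplexOfSet_I {n : ℕ} (S : Set (cell C n)) : (subcomplexOfSet S).I n = S := by
  ext e
  change (n < n ∨ ∃ f ∈ S, (⟨n, e⟩ : Σ k, cell C k) = ⟨n, f⟩) ↔ _
  simp

theorem le_of_I_subset {L M : Subcomplex C} (h : ∀ k, L.I k ⊆ M.I k) : L ≤ M := by
  intro x hx
  rw [← SetLike.mem_coe, ← CWComplex.Subcomplex.union (E := L)] at hx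
  obtain ⟨k, e, hx⟩ := mem_iUnion₂.1 hx
  exact CWComplex.Subcomplex.openCell_subset_of_mem M (h k e.2) hx

theorem skeletonLT_le_subcomplexOfSet {n : ℕ} (S : Set (cell C n)) :
    skeletonLT C (n : ℕ∞) ≤ subcomplexOfSet S :=
  le_of_I_subset fun _ e he => Or.inl (ENat.natCast_lt_natCast.1 ((mem_skeletonLT_I e _).1 he))

theorem mem_skeleton_I {k n : ℕ} (e : cell C k) : e ∈ (skeleton C (n : ℕ∞)).I k ↔ k ≤ n := by
  rw [mem_skeletonLT_I, ← Nat.lt_succ_iff, ← ENat.natCast_lt_natCast]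
  simp

theorem subcomplexOfSet_le_skeleton {n : ℕ} (S : Set (cell C n)) :
    subcomplexOfSet S ≤ skeleton C (n : ℕ∞) :=
  le_of_I_subset fun _ e he => (mem_skeleton_I e).2 <| by
    rcases he with he | ⟨f, -, hf⟩
    · exact he.le
    · exact (congrArg Sigma.fst hf).le

/-- A subcomplex between two consecutive skeleta is determined by its cells of top dimension. -/
theorem le_of_I_subset_of_skeleton {n : ℕ} {L M : Subcomplex C} (hL : L ≤ skeleton C (n : ℕ∞))
    (hM : skeletonLT C (n : ℕ∞) ≤ M) (h : L.I n ⊆ M.I n) : L ≤ M :=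
  le_of_I_subset fun k e he => by
    rcases ((mem_skeleton_I e).1 (I_subset_of_le hL k he)).lt_or_eq with hlt | rfl
    · exact I_subset_of_le hM k ((mem_skeletonLT_I e _).2 (ENat.natCast_lt_natCast.2 hlt))
    · exact h he

end Subcomplexes

/-! ### Spanning co-trees as coordinate complements -/

section Cotrees

variable {X : Type u} [TopologicalSpace X] [T2Space X] {C : Set X} [CWComplex C]
  [CWComplex.Finite C]

theorem SpanningCotree.ext_I {n : ℕ} {L M : SpanningCotree C n} (h : L.1.I n = M.1.I n) : L = M :=
  Subtype.ext (le_antisymm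
    (le_of_I_subset_of_skeleton L.2.le_skeleton M.2.skeletonLT_le h.le)
    (le_of_I_subset_of_skeleton M.2.le_skeleton L.2.skeletonLT_le h.ge))

/-- The rational boundaries that are cycles. Intersecting with the cycles makes it unnecessary to
know that `∂ ∘ ∂ = 0`, as the kernel of `Z_n(X; ℚ) → H_n(X; ℚ)` is this space by definition. -/
noncomputable def cycleBoundaries (C : Set X) [CWComplex C] [CWComplex.Finite C] (n : ℕ) :
    Submodule ℚ (Chain C ℚ n) :=
  boundaries C ℚ n ⊓ cycles C ℚ n

theorem phi_eq_iff {n : ℕ} {L : Subcomplex C} (w : subCycles L ℚ n) (z : cycles C ℚ n) :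
    phi L ℚ n w = Submodule.Quotient.mk z ↔ (w : Chain C ℚ n) - z ∈ boundaries C ℚ n :=
  Submodule.Quotient.eq _

theorem homologyIncl_bijective_iff {n : ℕ} {L : Subcomplex C} (hL : L ≤ skeleton C (n : ℕ∞)) :
    Function.Bijective (homologyIncl L ℚ n) ↔ Function.Bijective (phi L ℚ n) := by
  have h0 : (subBoundaries L ℚ n).submoduleOf (subCycles L ℚ n) = ⊥ := by
    rw [eq_bot_iff]
    rintro x ⟨y, hy, hyx⟩
    have hy0 : y = 0 := by
      funext e
      refine hy e fun he => ?_
      have := (mem_skeleton_I e).1 (I_subset_of_le hL (n + 1) he)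
      omega
    rw [hy0, map_zero] at hyx
    exact Subtype.ext hyx.symm
  have hq : Function.Bijective
      ((subBoundaries L ℚ n).submoduleOf (subCycles L ℚ n)).mkQ :=
    ⟨by rw [← LinearMap.ker_eq_bot, Submodule.ker_mkQ, h0], Submodule.mkQ_surjective _⟩
  rw [phi, LinearMap.coe_comp]
  exact (Function.Bijective.of_comp_iff _ hq).symm

theorem subBetti_eq_betti_iff {k : ℕ} {L : Subcomplex C}
    (hL : skeletonLT C ((k + 1 : ℕ) : ℕ∞) ≤ L) :
    subBetti L k = betti C k ↔ subChains L ℚ (k + 1) ⊔ cycles C ℚ (k + 1) = ⊤ := by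
  have hc : subCycles L ℚ k = cycles C ℚ k :=
    inf_eq_right.2 fun c _ e he => absurd (I_subset_of_le hL k
      ((mem_skeletonLT_I e _).2 (ENat.natCast_lt_natCast.2 k.lt_succ_self))) he
  have hle : subBoundaries L ℚ k ≤ boundaries C ℚ k := LinearMap.map_le_range
  have h1 : subBetti L k = betti C k ↔ subBoundaries L ℚ k = boundaries C ℚ k := by
    rw [subBetti, betti, hc, sub_right_inj, Nat.cast_inj]
    exact ⟨Submodule.eq_of_le_of_finrank_eq hle, fun h => by rw [h]⟩
  rw [h1, ← hle.ge_iff_eq, subBoundaries, boundaries, LinearMap.range_eq_map,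
    LinearMap.map_le_map_iff, top_le_iff]
  rfl

/-- A subcomplex between two consecutive skeleta is a spanning co-tree if and only if its space of
chains in the top degree is a complement of the space of boundaries that are cycles. -/
theorem isSpanningCotree_iff_isCompl {n : ℕ} {L : Subcomplex C}
    (h₁ : skeletonLT C (n : ℕ∞) ≤ L) (h₂ : L ≤ skeleton C (n : ℕ∞)) :
    IsSpanningCotree n L ↔ IsCompl (coordSubspace ℚ (L.I n)) (cycleBoundaries C n) := by
  have hbetti : (∀ k, k + 1 = n → subBetti L k = betti C k) ↔
      subChains L ℚ n ⊔ cycles C ℚ n = ⊤ := by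
    cases n with
    | zero => simp [cycles]
    | succ k =>
      rw [← subBetti_eq_betti_iff h₁]
      exact ⟨fun h => h k rfl, fun h j hj => by obtain rfl := Nat.succ_injective hj; exact h⟩
  change _ ↔ IsCompl (subChains L ℚ n) (cycleBoundaries C n)
  constructor
  · intro h
    have hφ := bijective_phi h
    have htop := hbetti.1 h.betti_eq
    refine ⟨Submodule.disjoint_def.2 fun x hx hxB => ?_, codisjoint_iff.2 (top_unique ?_)⟩
    · have : (⟨x, hx, hxB.2⟩ : subCycles L ℚ n) = 0 := hφ.1 <| by
        rw [map_zero]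
        exact (phi_eq_iff _ 0).2 (by simpa using hxB.1)
      exact congrArg Subtype.val this
    · rw [← htop]
      refine sup_le le_sup_left fun z hz => ?_
      obtain ⟨w, hw⟩ := hφ.2 (Submodule.Quotient.mk ⟨z, hz⟩)
      have hwz := (phi_eq_iff w ⟨z, hz⟩).1 hw
      rw [← sub_sub_cancel (w : Chain C ℚ n) z]
      exact sub_mem (Submodule.mem_sup_left w.2.1)
        (Submodule.mem_sup_right ⟨hwz, sub_mem w.2.2 hz⟩)
  · intro h
    refine ⟨(homologyIncl_bijective_iff h₂).2 ⟨?_, ?_⟩, hbetti.2 ?_, h₁, h₂⟩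
    · refine (injective_iff_map_eq_zero _).2 fun w hw => Subtype.ext ?_
      have := (phi_eq_iff w 0).1 hw
      exact Submodule.disjoint_def.1 h.disjoint _ w.2.1 ⟨by simpa using this, w.2.2⟩
    · intro y
      obtain ⟨z, rfl⟩ := Submodule.Quotient.mk_surjective _ y
      obtain ⟨w, hw, b, hb, hwb⟩ := Submodule.mem_sup.1
        (h.sup_eq_top ▸ Submodule.mem_top :
          (z : Chain C ℚ n) ∈ subChains L ℚ n ⊔ cycleBoundaries C n)
      have hwz : w - z = -b := by rw [← hwb]; abel
      have hwc : w ∈ cycles C ℚ n := by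
        rw [← sub_add_cancel w (z : Chain C ℚ n), hwz]
        exact add_mem (neg_mem hb.2) z.2
      refine ⟨⟨w, hw, hwc⟩, (phi_eq_iff _ z).2 ?_⟩
      change w - z ∈ _
      rw [hwz]
      exact neg_mem hb.1
    · exact top_unique (h.sup_eq_top.ge.trans (sup_le_sup_left inf_le_right _))

theorem SpanningCotree.isCompl {n : ℕ} (L : SpanningCotree C n) :
    IsCompl (coordSubspace ℚ (L.1.I n)) (cycleBoundaries C n) :=
  (isSpanningCotree_iff_isCompl L.2.skeletonLT_le L.2.le_skeleton).1 L.2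

/-- The spanning co-tree whose `n`-cells are a given set of coordinates complementary to the
boundaries. -/
def cotreeOfSet {n : ℕ} (S : Set (cell C n))
    (hS : IsCompl (coordSubspace ℚ S) (cycleBoundaries C n)) : SpanningCotree C n :=
  ⟨subcomplexOfSet S, (isSpanningCotree_iff_isCompl (skeletonLT_le_subcomplexOfSet S)
    (subcomplexOfSet_le_skeleton S)).2 (by rwa [subcomplexOfSet_I])⟩

theorem cotreeOfSet_I {n : ℕ} (S : Set (cell C n))
    (hS : IsCompl (coordSubspace ℚ S) (cycleBoundaries C n)) : (cotreeOfSet S hS).1.I n = S :=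
  subcomplexOfSet_I S

instance (n : ℕ) : Nonempty (SpanningCotree C n) :=
  let ⟨S, hS⟩ := exists_isCompl_coordSubspace (cycleBoundaries C n)
  ⟨cotreeOfSet S hS⟩

theorem eq_of_energy_minimal {n : ℕ} {E : cell C n → ℝ} (hE : Function.Injective E)
    {L M : SpanningCotree C n} (hL : ∀ L', energy E L ≤ energy E L')
    (hM : ∀ L', energy E M ≤ energy E L') : L = M := by
  have hle : ∀ {L : SpanningCotree C n}, (∀ L', energy E L ≤ energy E L') →
      ∀ U, IsCompl (coordSubspace ℚ U) (cycleBoundaries C n) →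
        ∑ b ∈ (Set.toFinite (L.1.I n)).toFinset, E b ≤ ∑ b ∈ (Set.toFinite U).toFinset, E b := by
    intro L hL U hU
    simpa only [energy, cotreeOfSet_I] using hL (cotreeOfSet U hU)
  exact SpanningCotree.ext_I (eq_of_exchange_of_sum_minimal hE
    (P := fun S => IsCompl (coordSubspace ℚ S) (cycleBoundaries C n))
    (fun S T hS hT e heS heT => exists_isCompl_coordSubspace_exchange hS hT heS heT)
    L.isCompl M.isCompl (hle hL) (hle hM))

/-! ### The relative homology groups are finite -/

/-- A rational decomposition of a chain into a boundary and a chain of `L` becomes integral after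
clearing the denominators, so `H_n(X, L; ℤ)` is a torsion group. -/
theorem aNum_pos {n : ℕ} (L : SpanningCotree C n) : 0 < aNum L := by
  have hfin : _root_.Finite (RelHomology L.1 ℤ n) := by
    refine Module.finite_of_fg_torsion _ fun {x} => ?_
    obtain ⟨⟨x, hx⟩, rfl⟩ := Submodule.Quotient.mk_surjective _ x
    obtain ⟨w, hw, b, hb, hwb⟩ := Submodule.mem_sup.1
      (L.isCompl.sup_eq_top ▸ Submodule.mem_top : chainCast ℤ ℚ n x ∈
        coordSubspace ℚ (L.1.I n) ⊔ cycleBoundaries C n)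
    obtain ⟨y, rfl⟩ := hb.1
    obtain ⟨N, hN⟩ := IsLocalization.exist_integer_multiples_of_finite (nonZeroDivisors ℤ) y
    choose y' hy' using hN
    have hyy : chainCast ℤ ℚ (n + 1) y' = (N : ℤ) • y := funext hy'
    refine ⟨N, (Submodule.Quotient.mk_eq_zero _).2 ?_⟩
    change (N : ℤ) • x ∈ boundaries C ℤ n ⊔ subChains L.1 ℤ n
    rw [← add_sub_cancel (boundary C ℤ n y') ((N : ℤ) • x)]
    refine add_mem (Submodule.mem_sup_left ⟨y', rfl⟩) (Submodule.mem_sup_right fun e he => ?_)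
    have hcast : chainCast ℤ ℚ n ((N : ℤ) • x - boundary C ℤ n y') = (N : ℤ) • w := by
      rw [map_sub, map_smul, ← boundary_chainCast, hyy, map_zsmul, ← hwb, smul_add,
        add_sub_cancel_right]
    have := congrFun hcast e
    rw [Pi.smul_apply, hw e he, smul_zero] at this
    exact Int.cast_injective (α := ℚ) (by simpa [chainCast] using this)
  exact Nat.card_pos

/-! ### Concentration of the Boltzmann weights -/

theorem tau_eq {n : ℕ} (E : cell C n → ℝ) (β : ℝ) (L : SpanningCotree C n) :
    tau E β L = (aNum L : ℝ) ^ 2 * Real.exp (-β * energy E L) := by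
  rw [tau, energy, Finset.mul_sum, Real.exp_sum]

open scoped Classical in
theorem tendsto_tau_div_nabla {n : ℕ} {E : cell C n → ℝ} (hE : Function.Injective E)
    {Lμ : SpanningCotree C n} (hμ : ∀ L', energy E Lμ ≤ energy E L') (L : SpanningCotree C n) :
    Tendsto (fun β : ℝ => tau E β L / nabla E β) atTop (𝓝 (if L = Lμ then 1 else 0)) := by
  simp only [nabla, tau_eq]
  refine tendsto_gibbs (fun L => pow_pos (Nat.cast_pos.2 (aNum_pos L)) 2) (fun L hL => ?_) L
  refine lt_of_le_of_ne (hμ L) fun h => hL (eq_of_energy_minimal hE (fun L' => ?_) hμ)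
  exact h ▸ hμ L'

end Cotrees

end CellBoltzmann

theorem corollaryB {X : Type u} [TopologicalSpace X] [T2Space X] (C : Set X) [CWComplex C]
    [CWComplex.Finite C] (n : ℕ) (E : cell C n → ℝ) (hE : Function.Injective E) :
    (∃! L : CellBoltzmann.SpanningCotree C n,
      ∀ L' : CellBoltzmann.SpanningCotree C n,
        CellBoltzmann.energy E L ≤ CellBoltzmann.energy E L') ∧
    ∀ Lμ : CellBoltzmann.SpanningCotree C n,
      (∀ L' : CellBoltzmann.SpanningCotree C n,
        CellBoltzmann.energy E Lμ ≤ CellBoltzmann.energy E L') →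
      Tendsto (fun β : ℝ => CellBoltzmann.tau E β Lμ / CellBoltzmann.nabla E β) atTop (𝓝 1) ∧
      (∀ L : CellBoltzmann.SpanningCotree C n, L ≠ Lμ →
        Tendsto (fun β : ℝ => CellBoltzmann.tau E β L / CellBoltzmann.nabla E β) atTop (𝓝 0)) ∧
      ∀ x : CellBoltzmann.Homology C ℤ n,
        Tendsto (fun β : ℝ => CellBoltzmann.boltzmann E β x) atTop
          (𝓝 (CellBoltzmann.cyclesCast ℚ ℝ n
            (CellBoltzmann.psi Lμ (CellBoltzmann.homologyCast ℤ ℚ n x)))) := by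

  classical
  refine ⟨?_, fun Lμ hμ => ?_⟩
  · obtain ⟨L, hL⟩ := Finite.exists_min (CellBoltzmann.energy (C := C) E)
    exact ⟨L, hL, fun M hM => CellBoltzmann.eq_of_energy_minimal hE hM hL⟩
  have hlim := CellBoltzmann.tendsto_tau_div_nabla hE hμ
  refine ⟨by simpa using hlim Lμ, fun L hL => by simpa [hL] using hlim L, fun x => ?_⟩
  have := tendsto_finsetSum Finset.univ fun L _ => (hlim L).smul_const
    (CellBoltzmann.cyclesCast ℚ ℝ n
      (CellBoltzmann.psi L (CellBoltzmann.homologyCast ℤ ℚ n x)))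
  simp only [ite_smul, one_smul, zero_smul, Finset.sum_ite_eq', Finset.mem_univ, if_true] at this
  refine this.congr fun β => ?_
  rw [CellBoltzmann.boltzmann, Finset.smul_sum]
  refine Finset.sum_congr rfl fun L _ => ?_
  rw [smul_smul, one_div_mul_eq_div]
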